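/- For $m\ge 1$ let $U^{(m)}=\{u\in\mathbb Z_3: u\equiv 1 \pmod{3^m}\}$, so that $U^{(1)}-U^{(2)}=(4+9\mathbb Z_3)\cup(7+9\mathbb Z_3)$. For $q\in U^{(1)}$ let $\iota_q:\mathbb Z_3\to\mathbb Z_3$ be the unique continuous function with $\iota_q(n)=1+q+q^2+\dots+q^{n-1}$ for all integers $n\ge 0$. Every $\iota_q$ fixes $0$ and $1$; a nontrivial $3$-adic fixed point of $\iota_q$ is an element $z\in\mathbb Z_3$ with $\iota_q(z)=z$ and $z\ne 0,1$. Theorem. There is a unique $q_0\in U^{(1)}-U^{(2)}$ with $q_0\equiv 7\pmod 9$ such that $\iota_{q_0}$ has no nontrivial $3$-adic fixed point, and there is a unique $q_1\in U^{(1)}-U^{(2)}$ with $q_1\equiv 4\pmod 9$ such that $\iota_{q_1}$ has no nontrivial $3$-adic fixed point. For every $q\in U^{(1)}-U^{(2)}$ with $q\notin\{q_0,q_1\}$, the function $\iota_q$ has exactly one nontrivial $3$-adic fixed point $z_q$. If $q\in 4+9\mathbb Z_3$ then $z_q\in 1+3\mathbb Z_3$, and if $q\in 7+9\mathbb Z_3$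 then $z_q\in 3\mathbb Z_3$. -/

import Mathlib

open Filter Topology

/-- The set `U^(m)` of the `p`-adic integers `u` with `u ≡ 1 (mod p ^ m)`. -/
def principalUnits (p : ℕ) [Fact p.Prime] (m : ℕ) : Set ℤ_[p] :=
  {u | (p : ℤ_[p]) ^ m ∣ u - 1}

/-- The `p`-adic interpolation `ι_q` of `n ↦ 1 + q + ⋯ + q ^ (n - 1)`: its value at `z` is the
limit of `1 + q + ⋯ + q ^ (n - 1)` as the natural number `n` tends `p`-adically to `z`.
For `q ∈ U^(1)` the limit exists, see `iota_isInterpolation`. -/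
noncomputable def iota {p : ℕ} [Fact p.Prime] (q z : ℤ_[p]) : ℤ_[p] :=
  limUnder (comap (Nat.cast : ℕ → ℤ_[p]) (𝓝 z)) (fun n : ℕ => ∑ i ∈ Finset.range n, q ^ i)

/-- A nontrivial `p`-adic fixed point of `ι_q`: a fixed point other than `0` and `1`. -/
def IsNontrivialFixedPoint {p : ℕ} [Fact p.Prime] (q z : ℤ_[p]) : Prop :=
  Function.IsFixedPt (iota q) z ∧ z ≠ 0 ∧ z ≠ 1

theorem iota_eq_of_interpolation {p : ℕ} [Fact p.Prime] {q : ℤ_[p]} {f : ℤ_[p] → ℤ_[p]}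
    (hf : Continuous f) (hn : ∀ n : ℕ, f n = ∑ i ∈ Finset.range n, q ^ i) : f = iota q := by
  funext z
  have hne : (comap (Nat.cast : ℕ → ℤ_[p]) (𝓝 z)).NeBot := by
    rw [comap_neBot_iff]
    intro t ht
    obtain ⟨x, hx, n, rfl⟩ := mem_closure_iff_nhds.1 (PadicInt.denseRange_natCast (p := p) z) t ht
    exact ⟨n, hx⟩
  refine (Tendsto.limUnder_eq ?_).symm
  simp only [← hn]
  exact (hf.tendsto z).comp tendsto_comap

/-- For `q ∈ U^(1)`, the function `ι_q` is the unique continuous function on `ℤ_p` whose value at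
every natural number `n` is `1 + q + ⋯ + q ^ (n - 1)`. -/
theorem iota_isInterpolation {p : ℕ} [Fact p.Prime] {q : ℤ_[p]} (hq : q ∈ principalUnits p 1) :
    (Continuous (iota q) ∧ ∀ n : ℕ, iota q n = ∑ i ∈ Finset.range n, q ^ i) ∧
    ∀ f : ℤ_[p] → ℤ_[p], Continuous f → (∀ n : ℕ, f n = ∑ i ∈ Finset.range n, q ^ i) →
      f = iota q := by
  refine ⟨?_, fun f hf hn => iota_eq_of_interpolation hf hn⟩
  suffices h : ∃ f : ℤ_[p] → ℤ_[p], Continuous f ∧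
      ∀ n : ℕ, f n = ∑ i ∈ Finset.range n, q ^ i by
    obtain ⟨f, hf, hn⟩ := h
    rw [← iota_eq_of_interpolation hf hn]
    exact ⟨hf, hn⟩
  have hX : Tendsto (fun i : ℕ => (q - 1) ^ i) atTop (𝓝 0) := by
    apply tendsto_pow_atTop_nhds_zero_of_norm_lt_one
    rw [PadicInt.norm_lt_one_iff_dvd]
    simpa [principalUnits] using hq
  have ha : Tendsto (fun i : ℕ => if i = 0 then 0 else (q - 1) ^ (i - 1)) atTop (𝓝 0) := by
    rw [← tendsto_add_atTop_iff_nat 1]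
    simpa using hX
  refine ⟨PadicInt.mahlerSeries (fun i : ℕ => if i = 0 then 0 else (q - 1) ^ (i - 1)),
    ContinuousMap.continuous _, fun n => ?_⟩
  induction n with
  | zero => rw [PadicInt.mahlerSeries_apply_nat ha le_rfl]; simp
  | succ n ih =>
    rw [Finset.sum_range_succ, ← ih, PadicInt.mahlerSeries_apply_nat ha le_rfl,
      PadicInt.mahlerSeries_apply_nat ha (Nat.le_succ n), Finset.sum_range_succ',
      Finset.sum_range_succ' _ (n + 1)]
    have hpow : q ^ n = ∑ i ∈ Finset.range (n + 1), n.choose i • (q - 1) ^ i := by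
      have h := add_pow (q - 1) 1 n
      simpa [mul_comm] using h
    rw [hpow]
    simp [Nat.choose_succ_succ, add_mul, Finset.sum_add_distrib, add_comm]

/-!
Write `q = 1 + 3 u`; the condition `q ∈ U^(1) - U^(2)` says that `u` is a unit. Expanding
`ι_q(z) = ∑ (z choose i) (3 u) ^ (i - 1)` and taking out the trivial zeros `z = 0, 1` gives
`2 (ι_q(z) - z) = 3 u z (z - 1) F(u, z)` with
`F(u, z) = 1 + (z - 2) u + 3 ∑ b_k u ^ (k + 2) (z - 2) (z - 3) ⋯ (z - k - 3)` and
`b_k = 2 * 3 ^ (k + 1) / (k + 4)!` (`two_mul_iota_sub_self`). By Legendre's formula the `b_k` are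
`3`-adic integers tending to `0` (`exists_tailCoeff`), so the sum is `1`-Lipschitz in each
variable (`norm_tsum_mul_eval_sub_le`), and modulo `3` the function `F` is `1 + (z - 2) u`.

A function `α + β z + p R(z)` on `ℤ_p` with `β` a unit and `R` `1`-Lipschitz has exactly one zero, by
the contraction principle (`existsUnique_zero_of_linear_add_prime_mul`). This applies to `F(u, ·)`,
so `F(u, ·)` has one zero `z_q`, congruent to `2 - u⁻¹` modulo `3`: it is the only possible
nontrivial fixed point. It applies also to `F(·, 0)` and `F(·, 1)`: there is exactly one `u` with
`z_q = 0`, and exactly one with `z_q = 1`, and these are the two exceptional parameters.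
-/

/-! ### Zeros of small Lipschitz perturbations of linear functions -/

section General

variable {p : ℕ} [Fact p.Prime]

theorem PadicInt.norm_le_norm_of_dvd {a b : ℤ_[p]} (h : a ∣ b) : ‖b‖ ≤ ‖a‖ := by
  obtain ⟨c, rfl⟩ := h
  rw [norm_mul]
  exact mul_le_of_le_one_right (norm_nonneg _) (PadicInt.norm_le_one c)

theorem summable_mul_padicInt {b : ℕ → ℤ_[p]} (hb : Tendsto b atTop (𝓝 0)) (c : ℕ → ℤ_[p]) :
    Summable fun k => b k * c k := by
  apply NonarchimedeanAddGroup.summable_of_tendsto_cofinite_zero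
  rw [Nat.cofinite_eq_atTop]
  refine squeeze_zero_norm (fun k => ?_) (tendsto_zero_iff_norm_tendsto_zero.1 hb)
  exact PadicInt.norm_le_norm_of_dvd (dvd_mul_right _ _)

/-- Polynomials with `p`-adic integer coefficients are `1`-Lipschitz on `ℤ_p`, and so is every
combination of them with coefficients tending to `0`. -/
theorem norm_tsum_mul_eval_sub_le {b : ℕ → ℤ_[p]} (hb : Tendsto b atTop (𝓝 0))
    (P : ℕ → Polynomial ℤ_[p]) (z w : ℤ_[p]) :
    ‖(∑' k, b k * (P k).eval z) - ∑' k, b k * (P k).eval w‖ ≤ ‖z - w‖ := by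
  rw [← (summable_mul_padicInt hb _).tsum_sub (summable_mul_padicInt hb _)]
  refine IsUltrametricDist.norm_tsum_le_of_forall_le_of_nonneg (norm_nonneg _) fun k => ?_
  rw [← mul_sub]
  exact PadicInt.norm_le_norm_of_dvd
    ((Polynomial.sub_dvd_eval_sub z w (P k)).mul_left _)

/-- The zeros are the fixed points of `z ↦ -β⁻¹ (α + p R(z))`, which is a contraction. -/
theorem existsUnique_zero_of_linear_add_prime_mul {α β : ℤ_[p]} (hβ : IsUnit β)
    {R : ℤ_[p] → ℤ_[p]} (hR : ∀ z w, ‖R z - R w‖ ≤ ‖z - w‖) :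
    ∃! z, α + β * z + p * R z = 0 := by
  obtain ⟨γ, hγ⟩ := hβ.exists_right_inv
  have hiff : ∀ z, α + β * z + p * R z = 0 ↔ -γ * (α + p * R z) = z := fun z =>
    ⟨fun h => by linear_combination (-γ) * h + z * hγ,
      fun h => by linear_combination (-β) * h - (α + p * R z) * hγ⟩
  have hp : ‖(p : ℤ_[p])‖₊ < 1 := (PadicInt.norm_lt_one_iff_dvd _).2 dvd_rfl
  have hc : ContractingWith ‖(p : ℤ_[p])‖₊ fun z => -γ * (α + p * R z) := by
    refine ⟨hp, LipschitzWith.of_dist_le_mul fun z w => ?_⟩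
    have he : -γ * (α + p * R z) - -γ * (α + p * R w) = -γ * (p * (R z - R w)) := by ring
    rw [dist_eq_norm, dist_eq_norm, he, norm_mul, norm_mul, coe_nnnorm]
    calc ‖-γ‖ * (‖(p : ℤ_[p])‖ * ‖R z - R w‖)
        ≤ 1 * (‖(p : ℤ_[p])‖ * ‖z - w‖) := by
          gcongr
          · exact PadicInt.norm_le_one _
          · exact hR z w
      _ = ‖(p : ℤ_[p])‖ * ‖z - w‖ := one_mul _
  refine ⟨hc.fixedPoint _, (hiff _).2 hc.fixedPoint_isFixedPt, fun z hz => ?_⟩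
  exact hc.fixedPoint_unique ((hiff z).1 hz)

end General

/-! ### Factorization of `ι_q(z) - z` -/

theorem three_ne_zero_padicInt : (3 : ℤ_[3]) ≠ 0 := by norm_num

/-- The numbers `2 * 3 ^ (k + 1) / (k + 4)!` are `3`-adic integers and tend to `0`. -/
theorem exists_tailCoeff : ∃ b : ℕ → ℤ_[3], Tendsto b atTop (𝓝 0) ∧
    ∀ k, b k * ((k + 4).factorial : ℤ_[3]) = 2 * 3 ^ (k + 1) := by
  -- Legendre: `v = v₃((k + 4)!)` satisfies `2 * v < k + 4`, hence `k / 2 + v ≤ k + 1`; the spare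
  -- factor `3 ^ (k / 2)` gives the convergence to `0`.
  have hdvd : ∀ k : ℕ, ∃ c : ℤ_[3],
      (3 : ℤ_[3]) ^ (k / 2) * (k + 4).factorial * c = 3 ^ (k + 1) := by
    intro k
    obtain ⟨m, hm⟩ := pow_padicValNat_dvd (p := 3) (n := (k + 4).factorial)
    have hm3 : ¬ 3 ∣ m := by
      rintro ⟨l, rfl⟩
      apply pow_succ_padicValNat_not_dvd (p := 3) (Nat.factorial_ne_zero (k + 4))
      exact ⟨l, by rw [pow_succ, mul_assoc]; exact hm⟩
    have hu : IsUnit (m : ℤ_[3]) := by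
      rw [PadicInt.isUnit_iff, PadicInt.norm_natCast_eq_one_iff]
      exact Nat.prime_three.coprime_iff_not_dvd.2 hm3
    obtain ⟨γ, hγ⟩ := hu.exists_right_inv
    have hv := sub_one_mul_padicValNat_factorial_lt_of_ne_zero (p := 3) (n := k + 4) (by omega)
    set v := padicValNat 3 (k + 4).factorial
    have hle : k / 2 + v ≤ k + 1 := by omega
    refine ⟨3 ^ (k + 1 - (k / 2 + v)) * γ, ?_⟩
    have hm' : ((k + 4).factorial : ℤ_[3]) = 3 ^ v * m := by
      exact_mod_cast congrArg (Nat.cast : ℕ → ℤ_[3]) hm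
    have hpow : (3 : ℤ_[3]) ^ (k + 1) = 3 ^ (k / 2) * 3 ^ v * 3 ^ (k + 1 - (k / 2 + v)) := by
      rw [← pow_add, ← pow_add]; congr 1; omega
    rw [hm', hpow]
    linear_combination (3 ^ (k / 2) * 3 ^ v * 3 ^ (k + 1 - (k / 2 + v))) * hγ
  choose c hc using hdvd
  refine ⟨fun k => 2 * 3 ^ (k / 2) * c k, ?_, fun k => by linear_combination 2 * hc k⟩
  have h3 : Tendsto (fun k : ℕ => (3 : ℤ_[3]) ^ k) atTop (𝓝 0) :=
    tendsto_pow_atTop_nhds_zero_of_norm_lt_one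
      ((PadicInt.norm_lt_one_iff_dvd 3).2 (by simp))
  have h3' := h3.comp (Nat.tendsto_div_const_atTop (n := 2) (by norm_num))
  refine squeeze_zero_norm (fun k => ?_) (tendsto_zero_iff_norm_tendsto_zero.1 h3')
  exact PadicInt.norm_le_norm_of_dvd ⟨2 * c k, by simp only [Function.comp]; ring⟩

/-- The `3`-adic integers `2 * 3 ^ (k + 1) / (k + 4)!`. -/
noncomputable def tailCoeff : ℕ → ℤ_[3] := exists_tailCoeff.choose

theorem tendsto_tailCoeff : Tendsto tailCoeff atTop (𝓝 0) := exists_tailCoeff.choose_spec.1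

theorem tailCoeff_mul_factorial (k : ℕ) :
    tailCoeff k * ((k + 4).factorial : ℤ_[3]) = 2 * 3 ^ (k + 1) :=
  exists_tailCoeff.choose_spec.2 k

/-- The series `∑ b_k u ^ (k + 2) (z - 2) (z - 3) ⋯ (z - k - 3)` with
`b_k = 2 * 3 ^ (k + 1) / (k + 4)!`. -/
noncomputable def tailSeries (u z : ℤ_[3]) : ℤ_[3] :=
  ∑' k, tailCoeff k * (u ^ (k + 2) * (descPochhammer ℤ_[3] (k + 2)).eval (z - 2))

/-- The cofactor `F(u, z)` in `2 (ι_q(z) - z) = 3 u z (z - 1) F(u, z)`, where `q = 1 + 3 u`. -/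
noncomputable def fixedPointCofactor (u z : ℤ_[3]) : ℤ_[3] :=
  1 + (z - 2) * u + 3 * tailSeries u z

theorem norm_tailSeries_sub_le_right (u z w : ℤ_[3]) :
    ‖tailSeries u z - tailSeries u w‖ ≤ ‖z - w‖ := by
  have h := norm_tsum_mul_eval_sub_le tendsto_tailCoeff (fun k =>
    Polynomial.C (u ^ (k + 2)) *
      (descPochhammer ℤ_[3] (k + 2)).comp (Polynomial.X - Polynomial.C 2)) z w
  simp only [Polynomial.eval_mul, Polynomial.eval_C, Polynomial.eval_comp, Polynomial.eval_sub,
    Polynomial.eval_X] at h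
  exact h

theorem norm_tailSeries_sub_le_left (z u v : ℤ_[3]) :
    ‖tailSeries u z - tailSeries v z‖ ≤ ‖u - v‖ := by
  have h := norm_tsum_mul_eval_sub_le tendsto_tailCoeff (fun k =>
    Polynomial.X ^ (k + 2) *
      Polynomial.C ((descPochhammer ℤ_[3] (k + 2)).eval (z - 2))) u v
  simp only [Polynomial.eval_mul, Polynomial.eval_C, Polynomial.eval_pow, Polynomial.eval_X] at h
  exact h

theorem continuous_fixedPointCofactor (u : ℤ_[3]) : Continuous (fixedPointCofactor u) := by
  have h : LipschitzWith 1 (tailSeries u) := LipschitzWith.of_dist_le_mul fun z w => by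
    simpa [dist_eq_norm] using norm_tailSeries_sub_le_right u z w
  have := h.continuous
  unfold fixedPointCofactor
  fun_prop

theorem natCast_mul_descPochhammer_eval (m k : ℕ) :
    ((m + 2 : ℕ) : ℤ_[3]) * (m + 1 : ℕ) * (descPochhammer ℤ_[3] k).eval (m : ℤ_[3]) =
      (k + 2).factorial * (m + 2).choose (k + 2) := by
  rw [descPochhammer_eval_eq_descFactorial]
  norm_cast
  rw [← Nat.descFactorial_eq_factorial_mul_choose, Nat.succ_descFactorial_succ,
    Nat.succ_descFactorial_succ, mul_assoc]

/-- The binomial expansion of `1 + q + ⋯ + q ^ (n - 1) = (q ^ n - 1) / (q - 1)`. -/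
theorem two_mul_geom_sum_sub_natCast (u : ℤ_[3]) (n : ℕ) :
    2 * (∑ i ∈ Finset.range n, (1 + 3 * u) ^ i - n) =
      3 * u * n * (n - 1) * fixedPointCofactor u n := by
  obtain _ | _ | m := n
  · simp
  · simp
  by_cases hu : u = 0
  · simp [hu]
  have hx : (3 * u : ℤ_[3]) ≠ 0 := mul_ne_zero (by norm_num) hu
  -- Multiplication by `q - 1` turns the geometric sum into `q ^ n - 1`.
  apply mul_left_cancel₀ hx
  have hcast : ((m + 1 + 1 : ℕ) : ℤ_[3]) - 2 = m := by push_cast; ring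
  have htail : tailSeries u (m + 1 + 1 : ℕ) = ∑ k ∈ Finset.range m,
      tailCoeff k * (u ^ (k + 2) * (descPochhammer ℤ_[3] (k + 2)).eval (m : ℤ_[3])) := by
    unfold tailSeries
    rw [hcast]
    refine tsum_eq_sum fun k hk => ?_
    rw [Finset.mem_range, not_lt] at hk
    rw [descPochhammer_eval_eq_descFactorial, Nat.descFactorial_of_lt (by omega)]
    simp
  have hgeom := mul_geom_sum (1 + 3 * u) (m + 1 + 1)
  rw [add_sub_cancel_left] at hgeom
  -- The binomial formula, with two vanishing terms added at the end to match `htail`.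
  have hbinom : (1 + 3 * u) ^ (m + 1 + 1) =
      ∑ i ∈ Finset.range (m + 4), (3 * u) ^ i * ((m + 2).choose i : ℤ_[3]) := by
    rw [add_comm, add_pow, Finset.sum_range_succ _ (m + 3)]
    simp
  rw [Finset.sum_range_succ', Finset.sum_range_succ', Finset.sum_range_succ',
    Finset.sum_range_succ'] at hbinom
  have hchoose : (2 : ℤ_[3]) * ((m + 2).choose 2 : ℤ_[3]) = (m + 2) * (m + 1) := by
    have := natCast_mul_descPochhammer_eval m 0
    simpa using this.symm
  have hchoose3 : (6 : ℤ_[3]) * ((m + 2).choose 3 : ℤ_[3]) = (m + 2) * (m + 1) * m := by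
    have := natCast_mul_descPochhammer_eval m 1
    simpa [Nat.factorial] using this.symm
  have hsum : 3 * (3 * u) ^ 2 * (((m : ℤ_[3]) + 2) * (m + 1)) * tailSeries u (m + 1 + 1 : ℕ) =
      2 * ∑ k ∈ Finset.range m,
        (3 * u) ^ (k + 1 + 1 + 1 + 1) * ((m + 2).choose (k + 1 + 1 + 1 + 1) : ℤ_[3]) := by
    rw [htail, Finset.mul_sum, Finset.mul_sum]
    refine Finset.sum_congr rfl fun k _ => ?_
    have h1 := natCast_mul_descPochhammer_eval m (k + 2)
    have h2 := tailCoeff_mul_factorial k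
    push_cast at h1
    linear_combination (3 * (3 * u) ^ 2 * tailCoeff k * u ^ (k + 2)) * h1 +
      3 * (3 * u) ^ 2 * u ^ (k + 2) * ((m + 2).choose (k + 4) : ℤ_[3]) * h2
  unfold fixedPointCofactor
  rw [hcast]
  rw [hbinom] at hgeom
  simp only [zero_add, Nat.choose_zero_right, Nat.choose_one_right, one_add_one_eq_two,
    two_add_one_eq_three] at hgeom
  push_cast at hgeom hsum ⊢
  linear_combination 2 * hgeom - hsum + (3 * u) ^ 2 * hchoose + 9 * u ^ 3 * hchoose3

theorem two_mul_iota_sub_self (u z : ℤ_[3]) :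
    2 * (iota (1 + 3 * u) z - z) = 3 * u * z * (z - 1) * fixedPointCofactor u z := by
  have hq : (1 + 3 * u : ℤ_[3]) ∈ principalUnits 3 1 := by simp [principalUnits]
  obtain ⟨⟨hcont, hnat⟩, -⟩ := iota_isInterpolation hq
  have hF := continuous_fixedPointCofactor u
  refine congrFun (PadicInt.denseRange_natCast.equalizer
    (g := fun z => 2 * (iota (1 + 3 * u) z - z))
    (h := fun z => 3 * u * z * (z - 1) * fixedPointCofactor u z)
    (by fun_prop) (by fun_prop) ?_) z
  funext n
  simp only [Function.comp, hnat]
  exact two_mul_geom_sum_sub_natCast u n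

theorem isNontrivialFixedPoint_iff {u z : ℤ_[3]} (hu : IsUnit u) :
    IsNontrivialFixedPoint (1 + 3 * u) z ↔ fixedPointCofactor u z = 0 ∧ z ≠ 0 ∧ z ≠ 1 := by
  have h := two_mul_iota_sub_self u z
  refine and_congr_left fun ⟨h0, h1⟩ => ?_
  rw [Function.IsFixedPt, ← sub_eq_zero]
  have h2 : (2 : ℤ_[3]) ≠ 0 := two_ne_zero
  have h3 : (3 : ℤ_[3]) * u * z * (z - 1) ≠ 0 :=
    mul_ne_zero (mul_ne_zero (mul_ne_zero three_ne_zero_padicInt hu.ne_zero) h0)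
      (sub_ne_zero.2 h1)
  rw [← mul_right_inj' h2, h, mul_zero, mul_eq_zero, or_iff_right h3]

/-! ### Zeros of the cofactor -/

theorem existsUnique_fixedPointCofactor_eq_zero {u : ℤ_[3]} (hu : IsUnit u) :
    ∃! z, fixedPointCofactor u z = 0 := by
  refine (existsUnique_congr fun z => ?_).1 (existsUnique_zero_of_linear_add_prime_mul
    (α := 1 - 2 * u) hu (norm_tailSeries_sub_le_right u))
  rw [fixedPointCofactor]
  push_cast
  ring_nf

theorem existsUnique_fixedPointCofactor_one_eq_zero : ∃! u, fixedPointCofactor u 1 = 0 := by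
  refine (existsUnique_congr fun u => ?_).1 (existsUnique_zero_of_linear_add_prime_mul
    (α := 1) (β := -1) isUnit_one.neg (norm_tailSeries_sub_le_left 1))
  rw [fixedPointCofactor]
  push_cast
  ring_nf

theorem existsUnique_fixedPointCofactor_zero_eq_zero : ∃! u, fixedPointCofactor u 0 = 0 := by
  have h2 : IsUnit (-2 : ℤ_[3]) := by
    have : IsUnit ((2 : ℕ) : ℤ_[3]) :=
      PadicInt.isUnit_iff.2 (PadicInt.norm_natCast_eq_one_iff.2 (by norm_num))
    exact_mod_cast this.neg
  refine (existsUnique_congr fun u => ?_).1 (existsUnique_zero_of_linear_add_prime_mul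
    (α := 1) h2 (norm_tailSeries_sub_le_left 0))
  rw [fixedPointCofactor]
  push_cast
  ring_nf

/-- Modulo `3`, the cofactor `F(u, z)` is `1 + (z - 2) u`. -/
theorem three_dvd_of_fixedPointCofactor_eq_zero {u z : ℤ_[3]} (h : fixedPointCofactor u z = 0) :
    (3 : ℤ_[3]) ∣ 1 + (z - 2) * u :=
  ⟨-tailSeries u z, by rw [fixedPointCofactor] at h; linear_combination h⟩

/-! ### The parameter `u = (q - 1) / 3` -/

theorem three_not_dvd_one : ¬ (3 : ℤ_[3]) ∣ 1 := fun h =>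
  (PadicInt.prime_p (p := 3)).not_isUnit (isUnit_of_dvd_one (by exact_mod_cast h))

theorem isUnit_iff_three_not_dvd {u : ℤ_[3]} : IsUnit u ↔ ¬ (3 : ℤ_[3]) ∣ u := by
  rw [← not_iff_not, not_not, PadicInt.not_isUnit_iff, PadicInt.norm_lt_one_iff_dvd,
    Nat.cast_ofNat]

theorem one_add_three_mul_mem_iff {u : ℤ_[3]} :
    1 + 3 * u ∈ principalUnits 3 1 \ principalUnits 3 2 ↔ IsUnit u := by
  have h : (3 : ℤ_[3]) ^ 2 ∣ 3 * u ↔ 3 ∣ u := by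
    rw [sq, mul_dvd_mul_iff_left three_ne_zero_padicInt]
  simp [principalUnits, h, isUnit_iff_three_not_dvd]

theorem exists_eq_one_add_three_mul {q : ℤ_[3]}
    (hq : q ∈ principalUnits 3 1 \ principalUnits 3 2) : ∃ u, IsUnit u ∧ q = 1 + 3 * u := by
  obtain ⟨u, hu⟩ : (3 : ℤ_[3]) ∣ q - 1 := by simpa [principalUnits] using hq.1
  obtain rfl : q = 1 + 3 * u := by linear_combination hu
  exact ⟨u, one_add_three_mul_mem_iff.1 hq, rfl⟩

theorem nine_dvd_iff {u a : ℤ_[3]} : 9 ∣ 1 + 3 * u - (1 + 3 * a) ↔ 3 ∣ u - a := by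
  rw [show (9 : ℤ_[3]) = 3 * 3 by norm_num,
    show 1 + 3 * u - (1 + 3 * a) = 3 * (u - a) by ring,
    mul_dvd_mul_iff_left three_ne_zero_padicInt]

theorem nine_dvd_sub_seven_iff {u : ℤ_[3]} : 9 ∣ 1 + 3 * u - 7 ↔ 3 ∣ u - 2 := by
  rw [← nine_dvd_iff]; norm_num

theorem nine_dvd_sub_four_iff {u : ℤ_[3]} : 9 ∣ 1 + 3 * u - 4 ↔ 3 ∣ u - 1 := by
  rw [← nine_dvd_iff]; norm_num

theorem isUnit_of_three_dvd_sub_one {u : ℤ_[3]} (h : 3 ∣ u - 1) : IsUnit u :=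
  isUnit_iff_three_not_dvd.2 fun h' => three_not_dvd_one (by simpa using dvd_sub h' h)

theorem isUnit_of_three_dvd_sub_two {u : ℤ_[3]} (h : 3 ∣ u - 2) : IsUnit u := by
  refine isUnit_iff_three_not_dvd.2 fun h' => three_not_dvd_one ?_
  obtain ⟨a, ha⟩ := h
  obtain ⟨b, hb⟩ := h'
  exact ⟨1 + a - b, by linear_combination ha - hb⟩

theorem three_dvd_sub_one_of_fixedPointCofactor_eq_zero {u z : ℤ_[3]}
    (h : fixedPointCofactor u z = 0) (hu : 3 ∣ u - 1) : 3 ∣ z - 1 := by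
  obtain ⟨a, ha⟩ := three_dvd_of_fixedPointCofactor_eq_zero h
  obtain ⟨b, hb⟩ := hu
  exact ⟨a - (z - 2) * b, by linear_combination ha - (z - 2) * hb⟩

theorem three_dvd_of_fixedPointCofactor_eq_zero_of_dvd {u z : ℤ_[3]}
    (h : fixedPointCofactor u z = 0) (hu : 3 ∣ u - 2) : 3 ∣ z := by
  obtain ⟨a, ha⟩ := three_dvd_of_fixedPointCofactor_eq_zero h
  obtain ⟨b, hb⟩ := hu
  exact ⟨z - 1 - a + (z - 2) * b, by linear_combination (z - 2) * hb - ha⟩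

/-- If the zero of `F(u, ·)` is `0` or `1`, then there is no nontrivial fixed point. -/
theorem not_isNontrivialFixedPoint {u w : ℤ_[3]} (hu : IsUnit u)
    (hw : fixedPointCofactor u w = 0) (hw' : w = 0 ∨ w = 1) (z : ℤ_[3]) :
    ¬ IsNontrivialFixedPoint (1 + 3 * u) z := by
  rw [isNontrivialFixedPoint_iff hu]
  rintro ⟨hz, h0, h1⟩
  obtain rfl := (existsUnique_fixedPointCofactor_eq_zero hu).unique hz hw
  exact hw'.elim h0 h1

theorem mainTheorem1 :
    ∃ q₀ q₁ : ℤ_[3],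
      (q₀ ∈ principalUnits 3 1 \ principalUnits 3 2 ∧ (9 : ℤ_[3]) ∣ q₀ - 7 ∧
        ∀ z : ℤ_[3], ¬ IsNontrivialFixedPoint q₀ z) ∧
      (∀ q ∈ principalUnits 3 1 \ principalUnits 3 2, (9 : ℤ_[3]) ∣ q - 7 →
        (∀ z : ℤ_[3], ¬ IsNontrivialFixedPoint q z) → q = q₀) ∧
      (q₁ ∈ principalUnits 3 1 \ principalUnits 3 2 ∧ (9 : ℤ_[3]) ∣ q₁ - 4 ∧
        ∀ z : ℤ_[3], ¬ IsNontrivialFixedPoint q₁ z) ∧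
      (∀ q ∈ principalUnits 3 1 \ principalUnits 3 2, (9 : ℤ_[3]) ∣ q - 4 →
        (∀ z : ℤ_[3], ¬ IsNontrivialFixedPoint q z) → q = q₁) ∧
      ∀ q ∈ principalUnits 3 1 \ principalUnits 3 2, q ≠ q₀ → q ≠ q₁ →
        ∃ z : ℤ_[3], IsNontrivialFixedPoint q z ∧
          (∀ z' : ℤ_[3], IsNontrivialFixedPoint q z' → z' = z) ∧
          ((9 : ℤ_[3]) ∣ q - 4 → (3 : ℤ_[3]) ∣ z - 1) ∧
          ((9 : ℤ_[3]) ∣ q - 7 → (3 : ℤ_[3]) ∣ z) := by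
  obtain ⟨u₀, h₀, hu₀⟩ := existsUnique_fixedPointCofactor_zero_eq_zero
  obtain ⟨u₁, h₁, hu₁⟩ := existsUnique_fixedPointCofactor_one_eq_zero
  have hd₀ : 3 ∣ u₀ - 2 := by
    obtain ⟨a, ha⟩ := three_dvd_of_fixedPointCofactor_eq_zero h₀
    exact ⟨a + u₀ - 1, by linear_combination ha⟩
  have hd₁ : 3 ∣ u₁ - 1 := by
    obtain ⟨a, ha⟩ := three_dvd_of_fixedPointCofactor_eq_zero h₁
    exact ⟨-a, by linear_combination -ha⟩
  have hU₀ := isUnit_of_three_dvd_sub_two hd₀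
  have hU₁ := isUnit_of_three_dvd_sub_one hd₁
  refine ⟨1 + 3 * u₀, 1 + 3 * u₁,
    ⟨one_add_three_mul_mem_iff.2 hU₀, nine_dvd_sub_seven_iff.2 hd₀,
      not_isNontrivialFixedPoint hU₀ h₀ (Or.inl rfl)⟩, fun q hq hq7 hno => ?_,
    ⟨one_add_three_mul_mem_iff.2 hU₁, nine_dvd_sub_four_iff.2 hd₁,
      not_isNontrivialFixedPoint hU₁ h₁ (Or.inr rfl)⟩, fun q hq hq4 hno => ?_,
    fun q hq hq₀ hq₁ => ?_⟩ <;>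
  obtain ⟨u, hu, rfl⟩ := exists_eq_one_add_three_mul hq <;>
  obtain ⟨z, hz, hzu⟩ := existsUnique_fixedPointCofactor_eq_zero hu
  · have hz3 := three_dvd_of_fixedPointCofactor_eq_zero_of_dvd hz (nine_dvd_sub_seven_iff.1 hq7)
    have hz1 : z ≠ 1 := by rintro rfl; exact three_not_dvd_one hz3
    obtain rfl : z = 0 := by
      by_contra hz0
      exact hno z ((isNontrivialFixedPoint_iff hu).2 ⟨hz, hz0, hz1⟩)
    rw [hu₀ u hz]
  · have hz3 := three_dvd_sub_one_of_fixedPointCofactor_eq_zero hz (nine_dvd_sub_four_iff.1 hq4)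
    have hz0 : z ≠ 0 := by rintro rfl; exact three_not_dvd_one (by simpa using hz3)
    obtain rfl : z = 1 := by
      by_contra hz1
      exact hno z ((isNontrivialFixedPoint_iff hu).2 ⟨hz, hz0, hz1⟩)
    rw [hu₁ u hz]
  · have hz0 : z ≠ 0 := by rintro rfl; exact hq₀ (by rw [hu₀ u hz])
    have hz1 : z ≠ 1 := by rintro rfl; exact hq₁ (by rw [hu₁ u hz])
    refine ⟨z, (isNontrivialFixedPoint_iff hu).2 ⟨hz, hz0, hz1⟩,
      fun z' hz' => hzu z' ((isNontrivialFixedPoint_iff hu).1 hz').1, fun h4 => ?_, fun h7 => ?_⟩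
    · exact three_dvd_sub_one_of_fixedPointCofactor_eq_zero hz (nine_dvd_sub_four_iff.1 h4)
    · exact three_dvd_of_fixedPointCofactor_eq_zero_of_dvd hz (nine_dvd_sub_seven_iff.1 h7)
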